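/- Let $q$ be a prime power, $\mathbb{F}$ a finite field with $q^2$ elements, and let $R=\mathbb{F}[X,Y]/\langle Y^q+Y-X^{q+1}\rangle$ be the coordinate ring of the affine Hermitian curve $H$. Let $P_1,\dots,P_n$ be all the rational points of $H$, listed without repetition, and for $\mu\in R$ put $\mathrm{ev}(\mu)=(\mu(P_1),\dots,\mu(P_n))\in\mathbb{F}^n$. For $\gamma\in\mathbb{F}$ let $\mathfrak{m}_{(P_i,\gamma)}\subset R[z]$ be the maximal ideal of all $f$ with $f(P_i,\gamma)=0$, let $\mathcal{O}_{(P_i,\gamma)}$ be the localization of $R[z]$ at it, and let $\hat{\mathcal{O}}_{(P_i,\gamma)}$ be the completion of this local ring with respect to its maximal ideal. The multiplicity $\mathrm{mult}_{(P_i,\gamma)}(f)$ of $f\in R[z]$ is the largest $r$ with $f\in\mathfrak{m}_{(P_i,\gamma)}^r$ (and $\infty$ if $f=0$). Let $M=[m_{i\gamma}]$, with $1\le i\le n$ and $\gamma\in\mathbb{F}$, be a family of nonnegative integers, and let $$I_M=\{f\in R[z]\mid \mathrm{mult}_{(P_i,\gamma)}(f)\ge m_{i\gamma}\text{ for all } 1\le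 i\le n,\ \gamma\in\mathbb{F}\},\qquad \mathrm{score}_M(v)=\sum_{i=1}^n m_{i v_i}\quad(v\in\mathbb{F}^n).$$ Let $\mu\in R$ and $v=\mathrm{ev}(\mu)$. Then $R[z]/(I_M+\langle z-\mu\rangle)$ is finite-dimensional over $\mathbb{F}$, and $$\dim_{\mathbb{F}} R[z]/(I_M+\langle z-\mu\rangle)=\mathrm{score}_M(v).$$ Moreover, for all $1\le i\le n$ and $\gamma\in\mathbb{F}$, the local quotient $\hat{\mathcal{O}}_{(P_i,\gamma)}/(I_M+\langle z-\mu\rangle)\hat{\mathcal{O}}_{(P_i,\gamma)}$ is isomorphic, as an $\mathbb{F}$-algebra, to $\mathbb{F}[[t]]/\langle t^{m_{i\gamma}}\rangle$ if $\mu(P_i)=\gamma$, and is the zero ring otherwise. -/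

import Mathlib

open Polynomial

namespace Hermitian

/-- The Hermitian polynomial `Y ^ q + Y - X ^ (q + 1)` in `F[X][Y]`; here `Polynomial.X` is the
variable `Y` and `Polynomial.C Polynomial.X` is the variable `X`. -/
noncomputable def curvePoly (F : Type*) [Field F] (q : ℕ) : F[X][X] :=
  X ^ q + X - C (X ^ (q + 1))

/-- The coordinate ring `R = F[X, Y] / (Y ^ q + Y - X ^ (q + 1))` of the affine Hermitian curve. -/
abbrev CoordRing (F : Type*) [Field F] (q : ℕ) : Type _ := AdjoinRoot (curvePoly F q)

/-- The rational points `(a, b)` of the affine Hermitian curve. -/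
@[ext]
structure Point (F : Type*) [Field F] (q : ℕ) where
  a : F
  b : F
  on_curve : b ^ q + b = a ^ (q + 1)

section

variable {F : Type*} [Field F] {q : ℕ}

/-- The value `φ(P)` of a function `φ` of the coordinate ring at a rational point `P`, as a
homomorphism of `F`-algebras. -/
noncomputable def evalPt (P : Point F q) : CoordRing F q →ₐ[F] F :=
  AdjoinRoot.liftAlgHom (curvePoly F q) (Polynomial.aeval P.a) P.b (by
    simp [curvePoly, eval₂_pow, P.on_curve])

/-- The value `f(P, γ)` of `f ∈ R[z]` at the rational point `(P, γ)` of the surface `H × 𝔸¹`. -/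
noncomputable def evalSurf (P : Point F q) (γ : F) : (CoordRing F q)[X] →+* F :=
  Polynomial.eval₂RingHom (evalPt P : CoordRing F q →+* F) γ

/-- The maximal ideal `{f ∈ R[z] | f(P, γ) = 0}` of the point `(P, γ)`. -/
noncomputable def maxIdeal (P : Point F q) (γ : F) : Ideal (CoordRing F q)[X] :=
  RingHom.ker (evalSurf P γ)

instance maxIdeal_isPrime (P : Point F q) (γ : F) : (maxIdeal P γ).IsPrime :=
  RingHom.ker_isPrime (evalSurf P γ)

/-- The multiplicity of `f ∈ R[z]` at `(P, γ)`: the largest `r` such that `f` lies in the `r`-th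
power of the maximal ideal of the point. It is `⊤` for `f = 0`. -/
noncomputable def mult (P : Point F q) (γ : F) (f : (CoordRing F q)[X]) : ℕ∞ :=
  ⨆ (r : ℕ) (_ : f ∈ maxIdeal P γ ^ r), (r : ℕ∞)

theorem le_mult_iff (P : Point F q) (γ : F) (f : (CoordRing F q)[X]) (m : ℕ) :
    (m : ℕ∞) ≤ mult P γ f ↔ f ∈ maxIdeal P γ ^ m := by
  constructor
  · intro h
    rcases Nat.eq_zero_or_pos m with rfl | hm
    · simp
    have h1 : ((m - 1 : ℕ) : ℕ∞) < mult P γ f :=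
      lt_of_lt_of_le (by exact_mod_cast Nat.sub_lt hm one_pos) h
    obtain ⟨r, h2⟩ := lt_iSup_iff.1 h1
    obtain ⟨hr, h3⟩ := lt_iSup_iff.1 h2
    have h4 : m - 1 < r := by exact_mod_cast h3
    exact Ideal.pow_le_pow_right (by omega) hr
  · intro h
    exact le_iSup₂_of_le m h le_rfl

/-- The evaluation map `φ ↦ (φ(P_1), …, φ(P_n))`. -/
noncomputable def ev {n : ℕ} (P : Fin n → Point F q) : CoordRing F q →ₗ[F] (Fin n → F) :=
  LinearMap.pi fun i => (evalPt (P i)).toLinearMap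

/-- The interpolation ideal `I_M` of the functions in `R[z]` whose multiplicity at `(P_i, γ)` is at
least `M i γ`, for all `i` and `γ`. -/
noncomputable def interpolationIdeal {n : ℕ} (P : Fin n → Point F q) (M : Fin n → F → ℕ) :
    Ideal (CoordRing F q)[X] where
  carrier := {f | ∀ i γ, (M i γ : ℕ∞) ≤ mult (P i) γ f}
  add_mem' := by
    intro f g hf hg i γ
    exact (le_mult_iff _ _ _ _).2
      (Ideal.add_mem _ ((le_mult_iff _ _ _ _).1 (hf i γ)) ((le_mult_iff _ _ _ _).1 (hg i γ)))
  zero_mem' := fun i γ => (le_mult_iff _ _ _ _).2 (Ideal.zero_mem _)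
  smul_mem' := by
    intro c f hf i γ
    exact (le_mult_iff _ _ _ _).2 (Ideal.mul_mem_left _ c ((le_mult_iff _ _ _ _).1 (hf i γ)))

theorem interpolationIdeal_eq_iInf {n : ℕ} (P : Fin n → Point F q) (M : Fin n → F → ℕ) :
    interpolationIdeal P M = ⨅ (i : Fin n) (γ : F), maxIdeal (P i) γ ^ M i γ := by
  ext f
  simp only [Ideal.mem_iInf, ← le_mult_iff]
  rfl

/-- The score `∑ i, m_{i, v_i}` of the vector `v` with respect to the multiplicity matrix `M`. -/
def score {n : ℕ} (M : Fin n → F → ℕ) (v : Fin n → F) : ℕ := ∑ i, M i (v i)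

/-- The local ring of the surface `H × 𝔸¹` at the point `(P, γ)`. -/
abbrev LocalRing (P : Point F q) (γ : F) : Type _ := Localization.AtPrime (maxIdeal P γ)

/-- The completion of the local ring at `(P, γ)` with respect to its maximal ideal. -/
abbrev CompletedLocalRing (P : Point F q) (γ : F) : Type _ :=
  AdicCompletion (IsLocalRing.maximalIdeal (LocalRing P γ)) (LocalRing P γ)

/-- The quotient of the completed local ring at `(P, γ)` by the extension of an ideal `J` of
`R[z]`. -/
abbrev LocalQuotient (P : Point F q) (γ : F) (J : Ideal (CoordRing F q)[X]) : Type _ :=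
  CompletedLocalRing P γ ⧸
    (J.map (algebraMap (CoordRing F q)[X] (LocalRing P γ))).map
      (algebraMap (LocalRing P γ) (CompletedLocalRing P γ))

end

end Hermitian

/-! Substituting `z = μ` identifies `R[z]/⟨z - μ⟩` with `R`. It sends the maximal ideal of `(P, γ)`
onto that of `P` when `μ(P) = γ`, and to the unit ideal otherwise. As `I_M` is a product of powers
of distinct maximal ideals, its image is the intersection of the powers `𝔪_{P_i} ^ m_{i,v_i}`
(`map_subst_interpolationIdeal`), and the Chinese remainder theorem splits the quotient into the
rings `R/𝔪_P ^ m`.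

Each of these is `F[t]/t^m` (`exists_jet`), because the curve is smooth: with `t = X - a`, the
equation for `Y - b` becomes `h ^ q + h = u(t)`, which has a unique solution by iteration since
`q`-th powers are additive.

For the local statement, localizing at `(P_i, γ)` leaves only one factor of `I_M`, and completing
does not change a quotient that kills a power of the maximal ideal
(`nonempty_adicCompletion_quotient_algEquiv`). -/

namespace Hermitian

/-! ### Solving `h ^ q + h = u` by iteration -/

section ArtinSchreier

variable {B : Type*} [CommRing B]

/-- The iterates of `h ↦ u - h ^ q`, converging to a solution of `h ^ q + h = u`. -/
def approxRoot (q : ℕ) (u : B) (k : ℕ) : B := (fun h => u - h ^ q)^[k] 0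

theorem approxRoot_succ (q : ℕ) (u : B) (k : ℕ) :
    approxRoot q u (k + 1) = u - approxRoot q u k ^ q :=
  Function.iterate_succ_apply' _ _ _

theorem map_approxRoot {C : Type*} [CommRing C] (f : B →+* C) (q : ℕ) (u : B) (k : ℕ) :
    f (approxRoot q u k) = approxRoot q (f u) k := by
  induction k with
  | zero => simp [approxRoot]
  | succ k ih => simp [approxRoot_succ, ih]

/-- Each step replaces the error by minus its `q`-th power, and `q * (k + 1) ≥ k + 2`. This is the
uniqueness half: a solution in `I` is determined modulo every power of `I`. -/
theorem sub_approxRoot_mem {q : ℕ} (hq : 2 ≤ q) (hsub : ∀ x y : B, (x - y) ^ q = x ^ q - y ^ q)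
    {I : Ideal B} {s u : B} (hs : s ∈ I) (hu : s ^ q + s = u) (k : ℕ) :
    s - approxRoot q u k ∈ I ^ (k + 1) := by
  induction k with
  | zero => simpa [approxRoot] using hs
  | succ k ih =>
    have h : s - approxRoot q u (k + 1) = -(s - approxRoot q u k) ^ q := by
      rw [hsub, approxRoot_succ, ← hu]; ring
    rw [h]
    refine neg_mem (Ideal.pow_le_pow_right ?_ (pow_mul I (k + 1) q ▸ Ideal.pow_mem_pow ih q))
    nlinarith

theorem approxRoot_mem (q : ℕ) (hq : q ≠ 0) {I : Ideal B} {u : B} (hu : u ∈ I) (k : ℕ) :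
    approxRoot q u k ∈ I := by
  induction k with
  | zero => simp [approxRoot]
  | succ k ih =>
    rw [approxRoot_succ]
    exact sub_mem hu (Ideal.pow_mem_of_mem _ ih _ (Nat.pos_of_ne_zero hq))

theorem approxRoot_succ_sub_mem {q : ℕ} (hq : 2 ≤ q)
    (hsub : ∀ x y : B, (x - y) ^ q = x ^ q - y ^ q) {I : Ideal B} {u : B} (hu : u ∈ I) (k : ℕ) :
    approxRoot q u (k + 1) - approxRoot q u k ∈ I ^ (k + 1) := by
  induction k with
  | zero => simpa [approxRoot, show q ≠ 0 by omega] using hu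
  | succ k ih =>
    have h : approxRoot q u (k + 1 + 1) - approxRoot q u (k + 1) =
        -(approxRoot q u (k + 1) - approxRoot q u k) ^ q := by
      rw [hsub, approxRoot_succ q u (k + 1), approxRoot_succ q u k]; ring
    rw [h]
    refine neg_mem (Ideal.pow_le_pow_right ?_ (pow_mul I (k + 1) q ▸ Ideal.pow_mem_pow ih q))
    nlinarith

/-- The existence half: the defect of an iterate is its difference from the next one, which vanishes
once `I` is nilpotent. -/
theorem approxRoot_pow_add {q : ℕ} (hq : 2 ≤ q) (hsub : ∀ x y : B, (x - y) ^ q = x ^ q - y ^ q)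
    {I : Ideal B} {u : B} (hu : u ∈ I) {m : ℕ} (hI : I ^ m = ⊥) :
    approxRoot q u m ^ q + approxRoot q u m = u := by
  have h := Ideal.pow_le_pow_right (I := I) m.le_succ (approxRoot_succ_sub_mem hq hsub hu m)
  rw [hI, Ideal.mem_bot, approxRoot_succ] at h
  linear_combination -h

end ArtinSchreier

theorem sub_pow_card_sqrt {F : Type*} [Field F] [Fintype F] {q : ℕ} (hq : IsPrimePow q)
    (hF : Fintype.card F = q ^ 2) {B : Type*} [CommRing B] [Algebra F B] (x y : B) :
    (x - y) ^ q = x ^ q - y ^ q := by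
  rcases subsingleton_or_nontrivial B with _ | _
  · exact Subsingleton.elim _ _
  obtain ⟨p, e, hp, -, rfl⟩ := (isPrimePow_nat_iff q).1 hq
  have : Fact p.Prime := ⟨hp⟩
  have : CharP F p := charP_of_card_eq_prime_pow (f := e * 2) (by rw [← pow_mul] at hF; simp [hF])
  have : CharP B p := charP_of_injective_algebraMap (algebraMap F B).injective p
  exact sub_pow_char_pow x y e

/-! ### Quotients of an adic completion -/

section Completion

/-- Since `f` kills `I ^ m`, it factors through `L / I ^ m` and so extends to the completion. -/
theorem nonempty_adicCompletion_quotient_algEquiv {k L A : Type*} [CommRing k]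
    [CommRing L] [CommRing A] [Algebra k L] [Algebra k A] {I : Ideal L} (hI : I.FG)
    (f : L →ₐ[k] A) (hf : Function.Surjective f) {m : ℕ} (hm : I ^ m ≤ RingHom.ker f) :
    Nonempty ((AdicCompletion I L ⧸ (RingHom.ker f).map (algebraMap L (AdicCompletion I L)))
      ≃ₐ[k] A) := by
  have : IsScalarTower k L (AdicCompletion I L) := .of_algebraMap_eq fun _ => rfl
  let g : AdicCompletion I L →ₐ[k] A :=
    (Ideal.Quotient.liftₐ (I ^ m) f hm).comp ((AdicCompletion.evalₐ I m).restrictScalars k)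
  have hg (x : L) : g (algebraMap L _ x) = f x := by
    simp only [g, AdicCompletion.algebraMap_apply, AlgHom.comp_apply,
      AlgHom.restrictScalars_apply, AdicCompletion.evalₐ_of]
    rfl
  have hgs : Function.Surjective g := fun a => by
    obtain ⟨x, rfl⟩ := hf a
    exact ⟨_, hg x⟩
  suffices h : RingHom.ker g = (RingHom.ker f).map (algebraMap L (AdicCompletion I L)) by
    rw [← h]
    exact ⟨Ideal.quotientKerAlgEquivOfSurjective hgs⟩
  refine le_antisymm (fun x hx => ?_) (Ideal.map_le_iff_le_comap.2 fun x hx => ?_)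
  · obtain ⟨y, hy⟩ := Ideal.Quotient.mk_surjective (AdicCompletion.eval I L m x)
    -- Finite generation of `I` enters here: it makes the kernel of the projection to level `m` the
    -- extension of `I ^ m`.
    have hxy : x - algebraMap L _ y ∈ I ^ m • (⊤ : Submodule L (AdicCompletion I L)) := by
      rw [AdicCompletion.pow_smul_top_eq_ker_eval hI, LinearMap.mem_ker, map_sub, ← hy,
        AdicCompletion.algebraMap_apply]
      exact sub_self _
    rw [Ideal.smul_top_eq_map, Submodule.restrictScalars_mem] at hxy
    have hxy' := Ideal.map_mono (f := algebraMap L (AdicCompletion I L)) hm hxy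
    have h0 : RingHom.ker g ≥ (RingHom.ker f).map (algebraMap L (AdicCompletion I L)) :=
      Ideal.map_le_iff_le_comap.2 fun x hx => by
        rw [Ideal.mem_comap, RingHom.mem_ker, hg]; exact hx
    have hy' : f y = 0 := by
      have := h0 hxy'
      rw [RingHom.mem_ker, map_sub, hg, hx, zero_sub, neg_eq_zero] at this
      exact this
    have := add_mem hxy' (Ideal.mem_map_of_mem (algebraMap L (AdicCompletion I L))
      (show y ∈ RingHom.ker f from hy'))
    simpa using this
  · rw [Ideal.mem_comap, RingHom.mem_ker, hg]; exact hx

end Completion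

/-! ### The algebra `F[t]/t^m` -/

section TruncatedPolynomials

variable {F : Type*} [Field F]

theorem finite_adjoinRoot_X_pow (m : ℕ) : Module.Finite F (AdjoinRoot (X ^ m : F[X])) :=
  (monic_X_pow m).finite_adjoinRoot

theorem finrank_adjoinRoot_X_pow (m : ℕ) : Module.finrank F (AdjoinRoot (X ^ m : F[X])) = m := by
  rw [(AdjoinRoot.powerBasis' (monic_X_pow (R := F) m)).finrank]; simp

theorem root_pow_eq_zero (m : ℕ) : AdjoinRoot.root (X ^ m : F[X]) ^ m = 0 := by
  rw [← AdjoinRoot.mk_X, ← map_pow, AdjoinRoot.mk_self]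

/-- Truncated polynomials and truncated power series agree. -/
theorem nonempty_adjoinRoot_X_pow_algEquiv (m : ℕ) :
    Nonempty (AdjoinRoot (X ^ m : F[X]) ≃ₐ[F]
      (PowerSeries F ⧸ Ideal.span {(PowerSeries.X : PowerSeries F) ^ m})) := by
  let g : F[X] →ₐ[F] PowerSeries F ⧸ Ideal.span {(PowerSeries.X : PowerSeries F) ^ m} :=
    (Ideal.Quotient.mkₐ F _).comp (Polynomial.coeToPowerSeries.algHom F)
  have hgs : Function.Surjective g := fun a => by
    obtain ⟨f, rfl⟩ := Ideal.Quotient.mk_surjective a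
    refine ⟨PowerSeries.trunc m f, ?_⟩
    refine (Ideal.Quotient.eq.2 (Ideal.mem_span_singleton.2 ?_))
    rw [PowerSeries.X_pow_dvd_iff]
    intro k hk
    simp [Polynomial.coeToPowerSeries.algHom_apply, PowerSeries.coeff_trunc, hk]
  suffices h : RingHom.ker g = Ideal.span {X ^ m} from
    ⟨(Ideal.quotientEquivAlgOfEq F h.symm).trans (Ideal.quotientKerAlgEquivOfSurjective hgs)⟩
  ext p
  rw [Ideal.mem_span_singleton, Polynomial.X_pow_dvd_iff, RingHom.mem_ker]
  refine Ideal.Quotient.eq_zero_iff_mem.trans ?_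
  rw [Ideal.mem_span_singleton, PowerSeries.X_pow_dvd_iff]
  simp [Polynomial.coeToPowerSeries.algHom_apply]

end TruncatedPolynomials

/-! ### Local parameters at rational points -/

section Jets

variable {F : Type*} [Field F] {q : ℕ}

/-- The coordinate function `X` of the Hermitian curve. -/
noncomputable def coordX (F : Type*) [Field F] (q : ℕ) : CoordRing F q :=
  AdjoinRoot.of (curvePoly F q) X

/-- The coordinate function `Y` of the Hermitian curve. -/
noncomputable def coordY (F : Type*) [Field F] (q : ℕ) : CoordRing F q :=
  AdjoinRoot.root (curvePoly F q)

theorem eval₂_curvePoly {B : Type*} [CommRing B] (g : F[X] →+* B) (y : B) :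
    (curvePoly F q).eval₂ g y = y ^ q + y - g X ^ (q + 1) := by
  simp [curvePoly, eval₂_pow]

theorem coordY_pow_add : coordY F q ^ q + coordY F q = coordX F q ^ (q + 1) := by
  rw [← sub_eq_zero]
  exact (eval₂_curvePoly _ _).symm.trans (AdjoinRoot.eval₂_root (curvePoly F q))

theorem coordRing_algHom_ext {B : Type*} [CommRing B] [Algebra F B] {f g : CoordRing F q →ₐ[F] B}
    (hX : f (coordX F q) = g (coordX F q)) (hY : f (coordY F q) = g (coordY F q)) : f = g :=
  AdjoinRoot.algHom_ext' (Polynomial.algHom_ext hX) hY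

theorem evalPt_coordX (P : Point F q) : evalPt P (coordX F q) = P.a := by
  simp [evalPt, coordX]

theorem evalPt_coordY (P : Point F q) : evalPt P (coordY F q) = P.b := by
  simp [evalPt, coordY]

/-- A point of the Hermitian curve with values in an algebra. -/
theorem exists_coordRing_algHom {B : Type*} [CommRing B] [Algebra F B] (x y : B)
    (h : y ^ q + y = x ^ (q + 1)) :
    ∃ f : CoordRing F q →ₐ[F] B, f (coordX F q) = x ∧ f (coordY F q) = y :=
  ⟨AdjoinRoot.liftAlgHom (curvePoly F q) (Polynomial.aeval x) y (by
    simp [eval₂_curvePoly, h]), by simp [coordX], by simp [coordY]⟩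

variable [Fintype F]

/-- A rational point of the Hermitian curve is smooth: the functions modulo the `m`-th power of its
maximal ideal are truncated polynomials in a local parameter. -/
theorem exists_jet (hq : IsPrimePow q) (hF : Fintype.card F = q ^ 2) (P : Point F q) (m : ℕ) :
    ∃ ψ : CoordRing F q →ₐ[F] AdjoinRoot (X ^ m : F[X]),
      Function.Surjective ψ ∧ RingHom.ker ψ = RingHom.ker (evalPt P) ^ m := by
  have hq2 : 2 ≤ q := hq.two_le
  set A := AdjoinRoot (X ^ m : F[X])
  set t : A := AdjoinRoot.root (X ^ m : F[X])
  set 𝔪 := RingHom.ker (evalPt P)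
  have hsubA := sub_pow_card_sqrt hq hF (B := A)
  have hq0 : q ≠ 0 := by omega
  -- The power series expansion of `Y - b` in the parameter `X - a`.
  let u {B : Type _} [CommRing B] [Algebra F B] (t : B) : B :=
    (algebraMap F B P.a + t) ^ (q + 1) - algebraMap F B P.a ^ (q + 1)
  have hu {B : Type _} [CommRing B] [Algebra F B] (t : B) : t ∣ u t := by
    simpa using sub_dvd_pow_sub_pow (algebraMap F B P.a + t) (algebraMap F B P.a) (q + 1)
  have hadd {B : Type _} [CommRing B] [Algebra F B] (x y : B) : (x + y) ^ q = x ^ q + y ^ q := by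
    have := sub_pow_card_sqrt hq hF (x + y) y
    rw [add_sub_cancel_right] at this
    linear_combination -this
  have hpt {B : Type _} [CommRing B] [Algebra F B] :
      algebraMap F B P.b ^ q + algebraMap F B P.b = algebraMap F B P.a ^ (q + 1) := by
    rw [← map_pow, ← map_add, P.on_curve, map_pow]
  let s : A := approxRoot q (u t) m
  have hut : u t ∈ Ideal.span {t} := Ideal.mem_span_singleton.2 (hu t)
  have hst : s ∈ Ideal.span {t} := approxRoot_mem q hq0 hut m
  have htm : Ideal.span {t} ^ m = ⊥ := by
    rw [Ideal.span_singleton_pow, root_pow_eq_zero, Ideal.span_singleton_eq_bot.2 rfl]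
  have hs : s ^ q + s = u t := approxRoot_pow_add hq2 hsubA hut htm
  obtain ⟨ψ, hψX, hψY⟩ := exists_coordRing_algHom (F := F) (q := q)
    (algebraMap F A P.a + t) (algebraMap F A P.b + s) (by
      rw [hadd]; linear_combination hs + hpt (B := A))
  -- The inverse map.
  let x : CoordRing F q ⧸ 𝔪 ^ m := Ideal.Quotient.mk _ (coordX F q - algebraMap F _ P.a)
  let y : CoordRing F q ⧸ 𝔪 ^ m := Ideal.Quotient.mk _ (coordY F q - algebraMap F _ P.b)
  have hmX : coordX F q - algebraMap F _ P.a ∈ 𝔪 := by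
    simp [𝔪, RingHom.mem_ker, evalPt_coordX]
  have hmY : coordY F q - algebraMap F _ P.b ∈ 𝔪 := by
    simp [𝔪, RingHom.mem_ker, evalPt_coordY]
  have hx : x ^ m = 0 := by
    rw [← map_pow, Ideal.Quotient.eq_zero_iff_mem]; exact Ideal.pow_mem_pow hmX m
  -- `Y - b` satisfies the shifted curve equation, so uniqueness forces the same expansion in `X -
  -- a` as the one defining `s`.
  have hy : y = approxRoot q (u x) m := by
    have h1 : (coordY F q - algebraMap F _ P.b) ^ q + (coordY F q - algebraMap F _ P.b) =
        u (coordX F q - algebraMap F _ P.a) := by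
      rw [sub_pow_card_sqrt hq hF]
      simp only [u, add_sub_cancel]
      linear_combination coordY_pow_add (F := F) (q := q) - hpt (B := CoordRing F q)
    have h2 := sub_approxRoot_mem hq2 (sub_pow_card_sqrt hq hF) hmY h1 m
    have h3 := (Ideal.Quotient.eq (I := 𝔪 ^ m)).2 (Ideal.pow_le_pow_right m.le_succ h2)
    rw [map_approxRoot] at h3
    refine h3.trans ?_
    simp only [u, x, map_sub, map_pow, map_add]
    rfl
  have hx0 : eval₂ (Algebra.ofId F (CoordRing F q ⧸ 𝔪 ^ m)).toRingHom x (X ^ m) = 0 := by simp [hx]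
  let θ : A →ₐ[F] CoordRing F q ⧸ 𝔪 ^ m :=
    AdjoinRoot.liftAlgHom (X ^ m : F[X]) (Algebra.ofId F _) x hx0
  have hθt : θ t = x := AdjoinRoot.lift_root hx0
  have hθ : θ.comp ψ = Ideal.Quotient.mkₐ F (𝔪 ^ m) := by
    apply coordRing_algHom_ext
    · simp [hψX, hθt, x]
    · have : θ s = y := by
        rw [hy, ← hθt]
        refine (map_approxRoot (RingHomClass.toRingHom θ) q (u t) m).trans ?_
        simp [u]
      simp [hψY, this, y]
  refine ⟨ψ, fun a => ?_, le_antisymm (fun f hf => ?_) ?_⟩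
  -- Polynomials in `X - a` already hit everything, as `X - a` maps to `t`.
  · have h : ψ.comp (aeval (coordX F q - algebraMap F _ P.a)) =
        Ideal.Quotient.mkₐ F (Ideal.span {(X ^ m : F[X])}) := by
      apply Polynomial.algHom_ext
      simp [hψX]; rfl
    obtain ⟨p, rfl⟩ := Ideal.Quotient.mkₐ_surjective F _ a
    exact ⟨_, DFunLike.congr_fun h p⟩
  · have h := DFunLike.congr_fun hθ f
    rw [AlgHom.comp_apply, show ψ f = 0 from hf, map_zero] at h
    exact Ideal.Quotient.eq_zero_iff_mem.1 h.symm
  -- Modulo `t`, `ψ` is evaluation at `P`; hence `𝔪` lands in `⟨t⟩` and `𝔪 ^ m` in `⟨t⟩ ^ m = 0`.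
  · have h : (Ideal.Quotient.mkₐ F (Ideal.span {t})).comp ψ =
        (Algebra.ofId F (A ⧸ Ideal.span {t})).comp (evalPt P) := by
      apply coordRing_algHom_ext
      · have : Ideal.Quotient.mk (Ideal.span {t}) t = 0 :=
          Ideal.Quotient.eq_zero_iff_mem.2 (Ideal.mem_span_singleton_self t)
        simp [hψX, evalPt_coordX, this]
      · have : Ideal.Quotient.mk (Ideal.span {t}) s = 0 := Ideal.Quotient.eq_zero_iff_mem.2 hst
        simp [hψY, evalPt_coordY, this]
    have hle : 𝔪 ≤ (Ideal.span {t}).comap ψ := fun f hf => by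
      have h := DFunLike.congr_fun h f
      rw [AlgHom.comp_apply, AlgHom.comp_apply, show evalPt P f = 0 from hf, map_zero] at h
      exact (Ideal.Quotient.eq_zero_iff_mem (I := Ideal.span {t})).1 h
    refine (Ideal.pow_right_mono hle m).trans ((Ideal.le_comap_pow _ m).trans ?_)
    rw [htm]; rfl

end Jets

/-! ### The global quotient -/

section Interpolation

theorem ideal_map_prod {Φ R S ι : Type*} [CommRing R] [CommRing S] [FunLike Φ R S]
    [RingHomClass Φ R S] (f : Φ) (s : Finset ι) (I : ι → Ideal R) :
    (∏ i ∈ s, I i).map f = ∏ i ∈ s, (I i).map f := by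
  classical
  induction s using Finset.induction_on with
  | empty => simpa [Ideal.one_eq_top] using Ideal.map_top f
  | insert i s hi ih => rw [Finset.prod_insert hi, Finset.prod_insert hi, Ideal.map_mul, ih]

variable {F : Type*} [Field F] {q : ℕ}

theorem evalSurf_surjective (P : Point F q) (γ : F) : Function.Surjective (evalSurf P γ) :=
  fun c => ⟨C (algebraMap F _ c), by simp [evalSurf]⟩

instance maxIdeal_isMaximal (P : Point F q) (γ : F) : (maxIdeal P γ).IsMaximal :=
  RingHom.ker_isMaximal_of_surjective _ (evalSurf_surjective P γ)

theorem evalPt_ker_isMaximal (P : Point F q) : (RingHom.ker (evalPt P)).IsMaximal :=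
  RingHom.ker_isMaximal_of_surjective _ fun c => ⟨algebraMap F _ c, by simp⟩

theorem evalPt_ker_injective : Function.Injective fun P : Point F q => RingHom.ker (evalPt P) := by
  intro P Q h
  have hX : coordX F q - algebraMap F _ P.a ∈ RingHom.ker (evalPt Q) := by
    rw [← show RingHom.ker (evalPt P) = RingHom.ker (evalPt Q) from h]
    simp [RingHom.mem_ker, evalPt_coordX]
  have hY : coordY F q - algebraMap F _ P.b ∈ RingHom.ker (evalPt Q) := by
    rw [← show RingHom.ker (evalPt P) = RingHom.ker (evalPt Q) from h]
    simp [RingHom.mem_ker, evalPt_coordY]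
  simp only [RingHom.mem_ker, map_sub, evalPt_coordX, evalPt_coordY, AlgHom.commutes,
    sub_eq_zero, Algebra.algebraMap_self_apply] at hX hY
  exact Point.ext hX.symm hY.symm

theorem comap_C_maxIdeal (P : Point F q) (γ : F) :
    (maxIdeal P γ).comap (C : CoordRing F q →+* (CoordRing F q)[X]) = RingHom.ker (evalPt P) := by
  ext f
  simp [maxIdeal, evalSurf, RingHom.mem_ker]

theorem X_sub_C_mem_maxIdeal_iff (P : Point F q) (γ : F) (μ : CoordRing F q) :
    X - C μ ∈ maxIdeal P γ ↔ evalPt P μ = γ := by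
  rw [maxIdeal, RingHom.mem_ker, evalSurf, map_sub, sub_eq_zero, eq_comm]
  simp

theorem maxIdeal_injective :
    Function.Injective fun x : Point F q × F => maxIdeal x.1 x.2 := by
  rintro ⟨P, γ⟩ ⟨Q, δ⟩ h
  replace h : maxIdeal P γ = maxIdeal Q δ := h
  have hPQ : P = Q := evalPt_ker_injective (by
    simp only [← comap_C_maxIdeal P γ, ← comap_C_maxIdeal Q δ, h])
  have hγ := (X_sub_C_mem_maxIdeal_iff P γ (algebraMap F _ γ)).2 (by simp)
  rw [h, X_sub_C_mem_maxIdeal_iff] at hγ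
  simpa [hPQ] using hγ

/-- The substitution `z ↦ μ`. -/
noncomputable def subst (μ : CoordRing F q) : (CoordRing F q)[X] →ₐ[F] CoordRing F q :=
  (aeval μ).restrictScalars F

theorem subst_apply (μ : CoordRing F q) (f : (CoordRing F q)[X]) : subst μ f = f.eval μ := by
  simp [subst, aeval_def, eval₂_eq_eval_map]

theorem subst_surjective (μ : CoordRing F q) : Function.Surjective (subst μ) :=
  fun f => ⟨C f, by simp [subst_apply]⟩

theorem ker_subst (μ : CoordRing F q) : RingHom.ker (subst μ) = Ideal.span {X - C μ} := by
  ext f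
  rw [Ideal.mem_span_singleton, dvd_iff_isRoot, RingHom.mem_ker, subst_apply, IsRoot.def]

theorem comap_map_subst (μ : CoordRing F q) (I : Ideal (CoordRing F q)[X]) :
    (I.map (subst μ)).comap (subst μ) = I ⊔ Ideal.span {X - C μ} := by
  rw [Ideal.comap_map_of_surjective' _ (subst_surjective μ), ker_subst]

theorem comap_subst_ker_evalPt (P : Point F q) (μ : CoordRing F q) :
    (RingHom.ker (evalPt P)).comap (subst μ) = maxIdeal P (evalPt P μ) := by
  ext f
  rw [Ideal.mem_comap, RingHom.mem_ker, maxIdeal, RingHom.mem_ker, subst_apply, evalSurf,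
    coe_eval₂RingHom]
  exact Iff.of_eq (congrArg (· = 0) (hom_eval₂ f (RingHom.id _) (evalPt P : _ →+* F) μ))

theorem map_subst_maxIdeal (P : Point F q) (μ : CoordRing F q) :
    (maxIdeal P (evalPt P μ)).map (subst μ) = RingHom.ker (evalPt P) := by
  rw [← comap_subst_ker_evalPt, Ideal.map_comap_of_surjective _ (subst_surjective μ)]

/-- Here `z - μ` does not vanish at `(P, γ)`, so together with the maximal ideal it generates the
whole ring. -/
theorem map_subst_maxIdeal_of_ne {P : Point F q} {μ : CoordRing F q} {γ : F}
    (h : evalPt P μ ≠ γ) : (maxIdeal P γ).map (subst μ) = ⊤ := by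
  have hlt : maxIdeal P γ < maxIdeal P γ ⊔ Ideal.span {X - C μ} :=
    left_lt_sup.2 fun hle => h ((X_sub_C_mem_maxIdeal_iff P γ μ).1
      (hle (Ideal.mem_span_singleton_self _)))
  rw [← Ideal.comap_eq_top_iff (f := subst μ), comap_map_subst]
  exact (maxIdeal_isMaximal P γ).1.2 _ hlt

variable {n : ℕ}

/-- Powers of distinct maximal ideals are coprime. The product form is what allows extension along
ring maps, which need not commute with intersections. -/
theorem interpolationIdeal_eq_prod [Fintype F] (P : Fin n → Point F q)
    (hP : Function.Injective P) (M : Fin n → F → ℕ) :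
    interpolationIdeal P M = ∏ x : Fin n × F, maxIdeal (P x.1) x.2 ^ M x.1 x.2 := by
  rw [interpolationIdeal_eq_iInf, Ideal.prod_eq_iInf_of_pairwise_isCoprime]
  · simp [iInf_prod]
  · intro x _ y _ hxy
    refine IsCoprime.pow (Ideal.isCoprime_of_isMaximal fun h => hxy ?_)
    have := maxIdeal_injective (a₁ := (P x.1, x.2)) (a₂ := (P y.1, y.2)) h
    simp only [Prod.mk.injEq] at this
    exact Prod.ext (hP this.1) this.2

theorem pairwise_isCoprime_ker_evalPt_pow (P : Fin n → Point F q) (hP : Function.Injective P)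
    (e : Fin n → ℕ) :
    Pairwise (Function.onFun IsCoprime fun i => RingHom.ker (evalPt (P i)) ^ e i) := by
  intro i j hij
  have := evalPt_ker_isMaximal (P i)
  have := evalPt_ker_isMaximal (P j)
  exact IsCoprime.pow (Ideal.isCoprime_of_isMaximal fun h => hij (hP (evalPt_ker_injective h)))

theorem map_subst_interpolationIdeal [Fintype F] (P : Fin n → Point F q)
    (hP : Function.Injective P) (M : Fin n → F → ℕ) (μ : CoordRing F q) :
    (interpolationIdeal P M).map (subst μ) =
      ⨅ i, RingHom.ker (evalPt (P i)) ^ M i (evalPt (P i) μ) := by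
  have h : ⨅ i, RingHom.ker (evalPt (P i)) ^ M i (evalPt (P i) μ) =
      ∏ i, RingHom.ker (evalPt (P i)) ^ M i (evalPt (P i) μ) := by
    rw [Ideal.prod_eq_iInf_of_pairwise_isCoprime]
    · simp
    · exact (pairwise_isCoprime_ker_evalPt_pow P hP _).set_pairwise _
  rw [h, interpolationIdeal_eq_prod P hP, ideal_map_prod, Fintype.prod_prod_type]
  refine Finset.prod_congr rfl fun i _ => ?_
  rw [Finset.prod_eq_single (evalPt (P i) μ)]
  · rw [Ideal.map_pow, map_subst_maxIdeal]
  · intro γ _ hγ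
    rw [Ideal.map_pow, map_subst_maxIdeal_of_ne hγ.symm, Ideal.top_pow, Ideal.one_eq_top]
  · simp

theorem nonempty_quotient_algEquiv_pi [Fintype F] (hq : IsPrimePow q)
    (hF : Fintype.card F = q ^ 2) (P : Fin n → Point F q) (hP : Function.Injective P)
    (M : Fin n → F → ℕ) (μ : CoordRing F q) :
    Nonempty (((CoordRing F q)[X] ⧸ (interpolationIdeal P M ⊔ Ideal.span {X - C μ})) ≃ₐ[F]
      ∀ i, AdjoinRoot (X ^ M i (evalPt (P i) μ) : F[X])) := by
  choose ψ hψ hker using fun i => exists_jet hq hF (P i) (M i (evalPt (P i) μ))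
  let Ψ := (AlgHom.pi ψ).comp (subst μ)
  have hΨ : Function.Surjective Ψ := by
    refine Function.Surjective.comp (g := AlgHom.pi ψ) (fun a => ?_) (subst_surjective μ)
    choose r hr using fun i => hψ i (a i)
    obtain ⟨f, hf⟩ := Ideal.pi_quotient_surjective
      (pairwise_isCoprime_ker_evalPt_pow P hP fun i => M i (evalPt (P i) μ))
      fun i => Ideal.Quotient.mk _ (r i)
    refine ⟨f, funext fun i => ?_⟩
    have h := Ideal.Quotient.eq.1 (hf i)
    rw [← hker, RingHom.mem_ker, map_sub, sub_eq_zero, hr] at h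
    exact h
  have hkerΨ : interpolationIdeal P M ⊔ Ideal.span {X - C μ} = RingHom.ker Ψ := by
    rw [← comap_map_subst, map_subst_interpolationIdeal P hP]
    ext f
    simp only [Ideal.mem_comap, Ideal.mem_iInf, ← hker]
    exact (funext_iff (f := Ψ f) (g := 0)).symm
  exact ⟨(Ideal.quotientEquivAlgOfEq F hkerΨ).trans (Ideal.quotientKerAlgEquivOfSurjective hΨ)⟩

theorem finite_and_finrank_quotient [Fintype F] (hq : IsPrimePow q)
    (hF : Fintype.card F = q ^ 2) (P : Fin n → Point F q) (hP : Function.Injective P)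
    (M : Fin n → F → ℕ) (μ : CoordRing F q) :
    Module.Finite F
        ((CoordRing F q)[X] ⧸ (interpolationIdeal P M ⊔ Ideal.span {X - C μ})) ∧
      Module.finrank F
        ((CoordRing F q)[X] ⧸ (interpolationIdeal P M ⊔ Ideal.span {X - C μ})) =
      score M (ev P μ) := by
  obtain ⟨e⟩ := nonempty_quotient_algEquiv_pi hq hF P hP M μ
  have (i : Fin n) := finite_adjoinRoot_X_pow (F := F) (M i (evalPt (P i) μ))
  have (i : Fin n) : Module.Free F (AdjoinRoot (X ^ M i (evalPt (P i) μ) : F[X])) :=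
    Module.Free.of_divisionRing _ _
  refine ⟨Module.Finite.equiv e.toLinearEquiv.symm, ?_⟩
  rw [e.toLinearEquiv.finrank_eq, Module.finrank_pi_fintype]
  simp only [finrank_adjoinRoot_X_pow]
  rfl

end Interpolation

/-! ### The local quotients -/

section Local

variable {F : Type*} [Field F] {q n : ℕ}

theorem ker_liftAlgHom_eq_map {k R L A : Type*} [CommRing k] [CommRing R] [CommRing L]
    [CommRing A] [Algebra k R] [Algebra k L] [Algebra k A] [Algebra R L] [IsScalarTower k R L]
    {S : Submonoid R} [IsLocalization S L] {f : R →ₐ[k] A} (hf : ∀ y : S, IsUnit (f y)) :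
    RingHom.ker (IsLocalization.liftAlgHom (S := L) hf) =
      (RingHom.ker f).map (algebraMap R L) := by
  refine le_antisymm (fun x hx => ?_) (Ideal.map_le_iff_le_comap.2 fun g hg => ?_)
  · obtain ⟨g, s, rfl⟩ := IsLocalization.exists_mk'_eq S x
    rw [IsLocalization.mk'_mem_map_algebraMap_iff S]
    refine ⟨1, one_mem _, ?_⟩
    rw [one_mul, RingHom.mem_ker]
    have h : IsLocalization.liftAlgHom (S := L) hf (algebraMap R L g) = 0 := by
      rw [← IsLocalization.mk'_spec L g s, map_mul, show IsLocalization.liftAlgHom (S := L) hf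
        (IsLocalization.mk' L g s) = 0 from hx, zero_mul]
    simpa using h
  · rw [Ideal.mem_comap, RingHom.mem_ker]
    simpa using hg

/-- Some function vanishes at `(Q, δ)` but not at `(P, γ)`, and it becomes a unit. -/
theorem map_maxIdeal_localRing_of_ne {P Q : Point F q} {γ δ : F} (h : (Q, δ) ≠ (P, γ)) :
    (maxIdeal Q δ).map (algebraMap _ (LocalRing P γ)) = ⊤ := by
  have hne : ¬ maxIdeal Q δ ≤ maxIdeal P γ := fun hle => h (maxIdeal_injective
    ((maxIdeal_isMaximal Q δ).eq_of_le (maxIdeal_isMaximal P γ).ne_top hle))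
  obtain ⟨f, hf, hf'⟩ := SetLike.not_le_iff_exists.1 hne
  exact Ideal.eq_top_of_isUnit_mem _ (Ideal.mem_map_of_mem _ hf)
    (IsLocalization.map_units (LocalRing P γ) (⟨f, hf'⟩ : (maxIdeal P γ).primeCompl))

theorem map_interpolationIdeal_localRing [Fintype F] (P : Fin n → Point F q)
    (hP : Function.Injective P) (M : Fin n → F → ℕ) (i : Fin n) (γ : F) :
    (interpolationIdeal P M).map (algebraMap _ (LocalRing (P i) γ)) =
      (maxIdeal (P i) γ ^ M i γ).map (algebraMap _ (LocalRing (P i) γ)) := by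
  rw [interpolationIdeal_eq_prod P hP, ideal_map_prod, Finset.prod_eq_single (i, γ)]
  · rintro ⟨j, δ⟩ - hne
    rw [Ideal.map_pow, map_maxIdeal_localRing_of_ne, Ideal.top_pow, Ideal.one_eq_top]
    intro h
    exact hne (Prod.ext (hP (congrArg Prod.fst h)) (Prod.ext_iff.1 h).2)
  · simp

theorem nonempty_localQuotient_algEquiv [Fintype F] (hq : IsPrimePow q)
    (hF : Fintype.card F = q ^ 2) (P : Fin n → Point F q) (hP : Function.Injective P)
    (M : Fin n → F → ℕ) (μ : CoordRing F q) (i : Fin n) :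
    Nonempty (LocalQuotient (P i) (evalPt (P i) μ)
        (interpolationIdeal P M ⊔ Ideal.span {X - C μ}) ≃ₐ[F]
      AdjoinRoot (X ^ M i (evalPt (P i) μ) : F[X])) := by
  set γ := evalPt (P i) μ
  obtain ⟨ψ, hψ, hker⟩ := exists_jet hq hF (P i) (M i γ)
  let χ := ψ.comp (subst μ)
  have hχker : RingHom.ker χ = maxIdeal (P i) γ ^ M i γ ⊔ Ideal.span {X - C μ} := by
    rw [← comap_map_subst, Ideal.map_pow, map_subst_maxIdeal, ← hker]
    rfl
  have hunit (f : (maxIdeal (P i) γ).primeCompl) : IsUnit (χ f) := by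
    have hf : evalPt (P i) (subst μ f) ≠ 0 := fun h => f.2 (by
      have hm : (f : (CoordRing F q)[X]) ∈ (RingHom.ker (evalPt (P i))).comap (subst μ) := h
      rwa [comap_subst_ker_evalPt] at hm)
    set c := evalPt (P i) (subst μ f)
    have hmem : subst μ f - algebraMap F _ c ∈ RingHom.ker (evalPt (P i)) := by
      simp [RingHom.mem_ker, c]
    -- The image is the nonzero constant `c` plus a nilpotent, hence a unit.
    have hnil : IsNilpotent (ψ (subst μ f - algebraMap F _ c)) := by
      refine ⟨M i γ, ?_⟩
      rw [← map_pow, ← RingHom.mem_ker, hker]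
      exact Ideal.pow_mem_pow hmem _
    have hc : IsUnit (algebraMap F (AdjoinRoot (X ^ M i γ : F[X])) c) :=
      (isUnit_iff_ne_zero.2 hf).map _
    have := hnil.isUnit_add_right_of_commute hc (Commute.all _ _)
    simpa [χ] using this
  let φ : LocalRing (P i) γ →ₐ[F] AdjoinRoot (X ^ M i γ : F[X]) :=
    IsLocalization.liftAlgHom hunit
  have hφ : Function.Surjective φ := fun a => by
    obtain ⟨f, rfl⟩ := hψ.comp (subst_surjective μ) a
    exact ⟨algebraMap _ _ f, IsLocalization.lift_eq hunit f⟩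
  have hφker : RingHom.ker φ = (interpolationIdeal P M ⊔ Ideal.span {X - C μ}).map
      (algebraMap _ (LocalRing (P i) γ)) := by
    rw [Ideal.map_sup, map_interpolationIdeal_localRing P hP, ← Ideal.map_sup, ← hχker]
    exact ker_liftAlgHom_eq_map hunit
  have hmax : IsLocalRing.maximalIdeal (LocalRing (P i) γ) ^ M i γ ≤ RingHom.ker φ := by
    rw [hφker, Ideal.map_sup, map_interpolationIdeal_localRing P hP,
      ← Localization.AtPrime.map_eq_maximalIdeal, ← Ideal.map_pow]
    exact le_sup_left
  have : IsNoetherianRing (LocalRing (P i) γ) :=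
    IsLocalization.isNoetherianRing (maxIdeal (P i) γ).primeCompl _ inferInstance
  have := nonempty_adicCompletion_quotient_algEquiv
    (IsLocalRing.maximalIdeal (LocalRing (P i) γ)).fg_of_isNoetherianRing φ hφ hmax
  rwa [hφker] at this

/-- Already in the local ring `z - μ` is a unit. -/
theorem subsingleton_localQuotient {P : Point F q} {γ : F} {μ : CoordRing F q}
    (h : evalPt P μ ≠ γ) (I : Ideal (CoordRing F q)[X]) :
    Subsingleton (LocalQuotient P γ (I ⊔ Ideal.span {X - C μ})) := by
  have hu : IsUnit (algebraMap _ (LocalRing P γ) (X - C μ)) :=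
    IsLocalization.map_units (LocalRing P γ)
      (⟨X - C μ, fun hm => h ((X_sub_C_mem_maxIdeal_iff P γ μ).1 hm)⟩ :
        (maxIdeal P γ).primeCompl)
  rw [LocalQuotient, Ideal.Quotient.subsingleton_iff, Ideal.eq_top_of_isUnit_mem _
    (Ideal.mem_map_of_mem _ (le_sup_right (a := I) (Ideal.mem_span_singleton_self _))) hu,
    Ideal.map_top]

end Local

end Hermitian

theorem mainTheorem7 {F : Type*} [Field F] [Fintype F] (q : ℕ) (hq : IsPrimePow q)
    (hF : Fintype.card F = q ^ 2) {n : ℕ} (P : Fin n ≃ Hermitian.Point F q)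
    (M : Fin n → F → ℕ) (μ : Hermitian.CoordRing F q) (v : Fin n → F)
    (hv : v = Hermitian.ev P μ) :
    (Module.Finite F ((Hermitian.CoordRing F q)[X] ⧸
        (Hermitian.interpolationIdeal P M ⊔ Ideal.span {X - C μ})) ∧
      Module.finrank F ((Hermitian.CoordRing F q)[X] ⧸
        (Hermitian.interpolationIdeal P M ⊔ Ideal.span {X - C μ})) = Hermitian.score M v) ∧
    ∀ (i : Fin n) (γ : F),
      (Hermitian.evalPt (P i) μ = γ →
        Nonempty (Hermitian.LocalQuotient (P i) γ
            (Hermitian.interpolationIdeal P M ⊔ Ideal.span {X - C μ}) ≃ₐ[F]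
          (PowerSeries F ⧸ Ideal.span {(PowerSeries.X : PowerSeries F) ^ M i γ}))) ∧
      (Hermitian.evalPt (P i) μ ≠ γ →
        Subsingleton (Hermitian.LocalQuotient (P i) γ
          (Hermitian.interpolationIdeal P M ⊔ Ideal.span {X - C μ}))) := by
  subst hv
  refine ⟨Hermitian.finite_and_finrank_quotient hq hF P P.injective M μ, fun i γ =>
    ⟨?_, fun h => Hermitian.subsingleton_localQuotient h _⟩⟩
  rintro rfl
  obtain ⟨e⟩ := Hermitian.nonempty_localQuotient_algEquiv hq hF P P.injective M μ i
  obtain ⟨e'⟩ := Hermitian.nonempty_adjoinRoot_X_pow_algEquiv (F := F)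
    (M i (Hermitian.evalPt (P i) μ))
  exact ⟨e.trans e'⟩
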